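/- Let $X$ and $Y$ be Tychonoff spaces, and let $C_p(X)$, $C_p(Y)$ denote the spaces of continuous real-valued functions on $X$ and $Y$ with the topology of pointwise convergence. Suppose that $X$ and $Y$ are $\Delta$-spaces, where a space $Z$ is called a $\Delta$-space if for every decreasing sequence $(D_n)_{n\in\omega}$ of subsets of $Z$ with empty intersection there is a decreasing sequence $(V_n)_{n\in\omega}$ of open subsets of $Z$, also with empty intersection, such that $D_n\subset V_n$ for every $n$. Let $T: C_p(X)\to C_p(Y)$ be a continuous linear bijection. Then each of the following conditions is equivalent to $T$ being an isomorphism of topological vector spaces: 1. $C_p(X)$ admits a base $\mathcal U$ of absolutely convex neighbourhoods of zero such that $\overline{T(U)}\subset 2T(U)$ for each $U\in\mathcal U$ (closure in $C_p(Y)$); 2. $T$ is an open mapping; 3. $C_p(X)$ admits a base $\mathcal U$ of absolutely convex closed neighbourhoods of zero such that $T(U)$ is closed in $C_p(Y)$ for each $U\in\mathcal U$. -/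

import Mathlib

open Set Topology
open scoped Pointwise

/-- A `Δ`-space: every decreasing sequence of (arbitrary) subsets with empty intersection is
contained, term by term, in a decreasing sequence of open sets with empty intersection. -/
def IsDeltaSpace (X : Type*) [TopologicalSpace X] : Prop :=
  ∀ D : ℕ → Set X, Antitone D → ⋂ n, D n = ∅ →
    ∃ V : ℕ → Set X, Antitone V ∧ (∀ n, IsOpen (V n)) ∧ ⋂ n, V n = ∅ ∧ ∀ n, D n ⊆ V n

/-- The space `C_p(X)`: the continuous real-valued functions on `X`, as a linear subspace of
`X → ℝ`. As a type it carries the topology induced by the product topology of `X → ℝ`,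
i.e. the topology of pointwise convergence. -/
def Cp (X : Type*) [TopologicalSpace X] : Submodule ℝ (X → ℝ) where
  carrier := {f | Continuous f}
  add_mem' hf hg := Continuous.add hf hg
  zero_mem' := continuous_const
  smul_mem' c _ hf := Continuous.const_smul hf c

/-- `𝒰` is a base of neighbourhoods of zero in `E`, consisting of absolutely convex sets. -/
def IsAbsConvexZeroBase {E : Type*} [AddCommGroup E] [Module ℝ E] [TopologicalSpace E]
    (𝒰 : Set (Set E)) : Prop :=
  (𝓝 (0 : E)).HasBasis (fun U : Set E => U ∈ 𝒰) id ∧ ∀ U ∈ 𝒰, AbsConvex ℝ U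

/-!
The topology of `C_p(X)` is a weak topology: every neighbourhood of zero contains the functions
vanishing on some finite subset of `X`, hence a subspace of finite codimension
(`Cp.exists_cofinite_submodule_subset`).

A continuous linear surjection `T : E → F` whose domain has this property is nearly open: the
closure of the image of a neighbourhood of zero is a neighbourhood of zero
(`closure_image_mem_nhds_zero_of_cofinite`). Indeed, if `N` is a subspace of finite codimension
contained in a small neighbourhood `V`, and `M` is the closure of `T(N)`, then `F ⧸ M` is a
finite-dimensional Hausdorff space, so `E → F ⧸ M` is open and `T(V) + M` is a neighbourhood of
zero; it is contained in the closure of `T(V + N)`.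

Consequently the inclusion of the closure of `T(U)` in `2 T(U)`, for `U` in a base at zero, makes
every `T(U)` a neighbourhood of zero, so that `T` is open
(`isOpenMap_of_closure_image_subset_smul`). When the sets `T(U)` are closed this inclusion holds
because they are balanced. The converse implications come from local convexity: an
isomorphism maps a base of closed absolutely convex sets to such a base.
-/

/-! ### Nearly open maps -/

/-- A continuous linear surjection is nearly open at zero as soon as every neighbourhood of zero in
its domain contains a subspace of finite codimension. -/
theorem closure_image_mem_nhds_zero_of_cofinite {E F : Type*}
    [AddCommGroup E] [Module ℝ E] [TopologicalSpace E] [IsTopologicalAddGroup E]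
    [ContinuousSMul ℝ E]
    [AddCommGroup F] [Module ℝ F] [TopologicalSpace F] [IsTopologicalAddGroup F]
    [ContinuousSMul ℝ F]
    (hE : ∀ U ∈ 𝓝 (0 : E), ∃ N : Submodule ℝ E, Module.Finite ℝ (E ⧸ N) ∧ (N : Set E) ⊆ U)
    (T : E →L[ℝ] F) (hT : Function.Surjective T) {U : Set E} (hU : U ∈ 𝓝 (0 : E)) :
    closure (T '' U) ∈ 𝓝 (0 : F) := by
  obtain ⟨V, hV, hVU⟩ := exists_nhds_zero_half hU
  obtain ⟨N, hN, hNV⟩ := hE V hV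
  set M : Submodule ℝ F := (N.map (T : E →ₗ[ℝ] F)).topologicalClosure
  have hNM : N ≤ M.comap (T : E →ₗ[ℝ] F) := fun x hx =>
    Submodule.le_topologicalClosure _ (Submodule.mem_map_of_mem hx)
  -- `M` is closed, which makes the quotient Hausdorff.
  have : IsClosed (M : Set F) := Submodule.isClosed_topologicalClosure _
  have : Module.Finite ℝ (F ⧸ M) := by
    refine Module.Finite.of_surjective (N.mapQ M (T : E →ₗ[ℝ] F) hNM) fun z => ?_
    obtain ⟨y, rfl⟩ := M.mkQ_surjective z
    obtain ⟨x, rfl⟩ := hT y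
    exact ⟨N.mkQ x, rfl⟩
  have hopen : IsOpenMap (M.mkQ ∘ₗ (T : E →ₗ[ℝ] F)) :=
    LinearMap.isOpenMap_of_finiteDimensional _ (M.mkQ_surjective.comp hT)
  have hVM : (M.mkQ ∘ₗ (T : E →ₗ[ℝ] F)) '' V ∈ 𝓝 (M.mkQ 0) := by
    simpa using hopen.image_mem_nhds hV
  have hmkQ : Continuous M.mkQ := M.continuous_mkQ
  filter_upwards [hmkQ.continuousAt hVM] with y hy
  obtain ⟨v, hv, hvy⟩ := hy
  have hm : -T v + y ∈ closure (T '' (N : Set E)) :=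
    (Submodule.Quotient.eq' M).1 (by simpa using hvy)
  have hy' := map_mem_closure (continuous_const_add (T v)) hm (t := T '' U) (by
    rintro _ ⟨n, hn, rfl⟩
    exact ⟨v + n, hVU v hv n (hNV hn), map_add T v n⟩)
  simpa using hy'

/-- The factor `c` absorbs the loss incurred by taking closures: it only has to be nonzero, since
a dilate of `T '' U` is a neighbourhood of zero exactly when `T '' U` is. -/
theorem isOpenMap_of_closure_image_subset_smul {E F : Type*}
    [AddCommGroup E] [Module ℝ E] [TopologicalSpace E] [IsTopologicalAddGroup E]
    [ContinuousSMul ℝ E]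
    [AddCommGroup F] [Module ℝ F] [TopologicalSpace F] [IsTopologicalAddGroup F]
    [ContinuousSMul ℝ F]
    (hE : ∀ U ∈ 𝓝 (0 : E), ∃ N : Submodule ℝ E, Module.Finite ℝ (E ⧸ N) ∧ (N : Set E) ⊆ U)
    (T : E →L[ℝ] F) (hT : Function.Surjective T) {𝒰 : Set (Set E)}
    (h𝒰 : (𝓝 (0 : E)).HasBasis (fun U : Set E => U ∈ 𝒰) id) {c : ℝ} (hc : c ≠ 0)
    (h : ∀ U ∈ 𝒰, closure (T '' U) ⊆ c • (T '' U)) : IsOpenMap T := by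
  refine (IsTopologicalAddGroup.isOpenMap_iff_nhds_zero (f := T)).2 ?_
  intro S hS
  obtain ⟨U, hU, hUS⟩ := h𝒰.mem_iff.1 (Filter.mem_map.1 hS)
  have hTU : T '' U ∈ 𝓝 (0 : F) :=
    (set_smul_mem_nhds_zero_iff hc).1 <| Filter.mem_of_superset
      (closure_image_mem_nhds_zero_of_cofinite hE T hT (h𝒰.mem_of_mem hU)) (h U hU)
  exact Filter.mem_of_superset hTU (image_subset_iff.2 hUS)

theorem ContinuousLinearMap.isInvertible_iff_isOpenMap_of_bijective {E F : Type*}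
    [AddCommGroup E] [Module ℝ E] [TopologicalSpace E]
    [AddCommGroup F] [Module ℝ F] [TopologicalSpace F]
    (T : E →L[ℝ] F) (hT : Function.Bijective T) : T.IsInvertible ↔ IsOpenMap T := by
  constructor
  · rintro ⟨e, rfl⟩
    exact e.toHomeomorph.isOpenMap
  · intro h
    let e := LinearEquiv.ofBijective (T : E →ₗ[ℝ] F) hT
    exact ⟨{ e with
      continuous_toFun := T.continuous
      continuous_invFun := e.toEquiv.continuous_symm_iff.2 h }, rfl⟩

theorem IsAbsConvexZeroBase.image_subset_two_smul {E F : Type*}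
    [AddCommGroup E] [Module ℝ E] [TopologicalSpace E] [AddCommGroup F] [Module ℝ F]
    [TopologicalSpace F] {𝒰 : Set (Set E)} (h𝒰 : IsAbsConvexZeroBase 𝒰) (T : E →L[ℝ] F)
    {U : Set E} (hU : U ∈ 𝒰) : T '' U ⊆ (2 : ℝ) • (T '' U) := by
  rw [← image_smul_set]
  exact image_mono ((h𝒰.2 U hU).1.subset_smul (by norm_num))

/-! ### The topology of pointwise convergence -/

/-- The subspace is that of the functions vanishing on a finite set `s`; its codimension is at most
the cardinality of `s`. -/
theorem Cp.exists_cofinite_submodule_subset {X : Type*} [TopologicalSpace X] (U : Set (Cp X))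
    (hU : U ∈ 𝓝 (0 : Cp X)) :
    ∃ N : Submodule ℝ (Cp X), Module.Finite ℝ (Cp X ⧸ N) ∧ (N : Set (Cp X)) ⊆ U := by
  obtain ⟨W, hW, hWU⟩ := mem_nhds_induced _ _ _ |>.1 hU
  rw [nhds_pi, Filter.mem_pi'] at hW
  obtain ⟨s, t, ht, hst⟩ := hW
  let r : Cp X →ₗ[ℝ] (s → ℝ) := LinearMap.funLeft ℝ ℝ ((↑) : s → X) ∘ₗ (Cp X).subtype
  refine ⟨LinearMap.ker r, Module.Finite.equiv r.quotKerEquivRange.symm, fun f hf => hWU (hst ?_)⟩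
  intro x hx
  have hfx : (f : X → ℝ) x = 0 := congrFun (LinearMap.mem_ker.1 hf) ⟨x, hx⟩
  simpa [hfx] using mem_of_mem_nhds (ht x)

theorem Cp.exists_isAbsConvexZeroBase_isClosed (X : Type*) [TopologicalSpace X] :
    ∃ 𝒰 : Set (Set (Cp X)), IsAbsConvexZeroBase 𝒰 ∧ ∀ U ∈ 𝒰, IsClosed U :=
  ⟨{U | U ∈ 𝓝 0 ∧ IsClosed U ∧ AbsConvex ℝ U},
    ⟨nhds_hasBasis_absConvex_closed ℝ (Cp X), fun _ hU => hU.2.2⟩, fun _ hU => hU.2.1⟩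

/-! ### Characterisations of isomorphisms -/

theorem corollary1p4 {X Y : Type*} [TopologicalSpace X] [T35Space X]
    [TopologicalSpace Y] [T35Space Y]
    (hX : IsDeltaSpace X) (hY : IsDeltaSpace Y)
    (T : Cp X →L[ℝ] Cp Y) (hT : Function.Bijective T) :
    (T.IsInvertible ↔
      ∃ 𝒰 : Set (Set (Cp X)), IsAbsConvexZeroBase 𝒰 ∧
        ∀ U ∈ 𝒰, closure (T '' U) ⊆ (2 : ℝ) • (T '' U)) ∧
    (T.IsInvertible ↔ IsOpenMap T) ∧
    (T.IsInvertible ↔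
      ∃ 𝒰 : Set (Set (Cp X)), IsAbsConvexZeroBase 𝒰 ∧
        (∀ U ∈ 𝒰, IsClosed U) ∧ ∀ U ∈ 𝒰, IsClosed (T '' U)) := by
  have hiff := T.isInvertible_iff_isOpenMap_of_bijective hT
  have of_two : (∃ 𝒰 : Set (Set (Cp X)), IsAbsConvexZeroBase 𝒰 ∧
      ∀ U ∈ 𝒰, closure (T '' U) ⊆ (2 : ℝ) • (T '' U)) → T.IsInvertible := by
    rintro ⟨𝒰, h𝒰, h⟩
    exact hiff.2 (isOpenMap_of_closure_image_subset_smul Cp.exists_cofinite_submodule_subset T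
      hT.surjective h𝒰.1 two_ne_zero h)
  have to_two : (∃ 𝒰 : Set (Set (Cp X)), IsAbsConvexZeroBase 𝒰 ∧
      (∀ U ∈ 𝒰, IsClosed U) ∧ ∀ U ∈ 𝒰, IsClosed (T '' U)) →
      ∃ 𝒰 : Set (Set (Cp X)), IsAbsConvexZeroBase 𝒰 ∧
        ∀ U ∈ 𝒰, closure (T '' U) ⊆ (2 : ℝ) • (T '' U) := by
    rintro ⟨𝒰, h𝒰, -, h⟩
    exact ⟨𝒰, h𝒰, fun U hU => (h U hU).closure_eq.trans_subset (h𝒰.image_subset_two_smul T hU)⟩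
  have to_closed : T.IsInvertible → ∃ 𝒰 : Set (Set (Cp X)), IsAbsConvexZeroBase 𝒰 ∧
      (∀ U ∈ 𝒰, IsClosed U) ∧ ∀ U ∈ 𝒰, IsClosed (T '' U) := by
    rintro ⟨e, rfl⟩
    obtain ⟨𝒰, h𝒰, h⟩ := Cp.exists_isAbsConvexZeroBase_isClosed X
    exact ⟨𝒰, h𝒰, h, fun U hU => e.toHomeomorph.isClosedMap U (h U hU)⟩
  exact ⟨⟨fun h => to_two (to_closed h), of_two⟩, hiff, ⟨to_closed, fun h => of_two (to_two h)⟩⟩
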